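/- For positive real numbers $r_1,r_2,r_3,r_4$, call $r=(r_1,r_2,r_3,r_4)$ *admissible* if there is a nondegenerate tetrahedron $T(r)$ in Euclidean space $\mathbb{E}^3$ whose edge joining the $i$-th and $j$-th vertices has length $l_{ij}=r_i+r_j$ for all $i\neq j$ (a conformal tetrahedron). Let $\alpha_{ij}$ be the interior dihedral angle of $T(r)$ at the edge joining vertices $i$ and $j$, let $S_i=-\pi+\sum_{j\ne i}\alpha_{ij}$ be the solid angle at vertex $i$, and put $S(r)=\sum_{i=1}^4 r_iS_i$. The set of admissible $r$ is open in $\mathbb{R}^4$; on it $S$ is twice continuously differentiable, each $S_i$ is differentiable, and $$\frac{\partial^2 S}{\partial r_i\,\partial r_j}=\frac{\partial S_i}{\partial r_j}\qquad (1\le i,j\le 4).$$ At every admissible $r$, the Hessian matrix $H(S)=\left(\frac{\partial^2 S}{\partial r_i\,\partial r_j}\right)_{i,j}$ is symmetric and negative semidefinite, and its kernel is exactly the line spanned by $(r_1,r_2,r_3,r_4)$. -/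

import Mathlib

open scoped RealInnerProductSpace

noncomputable section

namespace ConformalSimplex

/-- Euclidean three-space. -/
abbrev E3 : Type := EuclideanSpace ℝ (Fin 3)

/-- Interior dihedral angle of the tetrahedron `a b c d` at the edge `a b`: the angle between the
components of the edge vectors `a c` and `a d` that are orthogonal to the edge `a b`. -/
def dihedralAngle (a b c d : E3) : ℝ :=
  InnerProductGeometry.angle
    ((Submodule.span ℝ {b - a})ᗮ.starProjection (c - a))
    ((Submodule.span ℝ {b - a})ᗮ.starProjection (d - a))

/-- Solid angle at the vertex `a` of the tetrahedron `a b c d`: the sum of the dihedral angles at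
the three edges issuing from `a`, minus `π`. -/
def vertexSolidAngle (a b c d : E3) : ℝ :=
  -Real.pi + (dihedralAngle a b c d + dihedralAngle a c b d + dihedralAngle a d b c)

/-- `p` is the list of vertices of a (nondegenerate) Euclidean tetrahedron with edge lengths
`r i + r j`. -/
structure IsRealization (r : Fin 4 → ℝ) (p : Fin 4 → E3) : Prop where
  affineIndependent : AffineIndependent ℝ p
  dist_eq : ∀ i j, i ≠ j → dist (p i) (p j) = r i + r j

/-- The set of conformal Euclidean tetrahedra `T(r₁, r₂, r₃, r₄)`, parametrized by the radii. -/
def conformalSet : Set (Fin 4 → ℝ) :=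
  {r | (∀ i, 0 < r i) ∧ ∃ p : Fin 4 → E3, IsRealization r p}

open Classical in
/-- The solid angle `S_i` at the vertex `i` of `T(r)` as a function of the radii (`0` when `r` is
not in `conformalSet`). The vertices other than `i` are `i + 1`, `i + 2`, `i + 3` modulo `4`.
The choice of the realization is immaterial: see `solidAngle_eq`. -/
def solidAngle (i : Fin 4) (r : Fin 4 → ℝ) : ℝ :=
  if h : r ∈ conformalSet then
    vertexSolidAngle (h.2.choose i) (h.2.choose (i + 1)) (h.2.choose (i + 2)) (h.2.choose (i + 3))
  else 0

/-- The function `S = ∑ r_i S_i`. -/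
def totalS (r : Fin 4 → ℝ) : ℝ := ∑ i, r i * solidAngle i r

/-- The partial derivative `∂f / ∂r_j` at `r`. -/
def pderiv (j : Fin 4) (f : (Fin 4 → ℝ) → ℝ) (r : Fin 4 → ℝ) : ℝ :=
  fderiv ℝ f r (Pi.single j 1)

/-- The Hessian matrix `(∂² f / ∂r_i ∂r_j)` at `r`. -/
def hessian (f : (Fin 4 → ℝ) → ℝ) (r : Fin 4 → ℝ) : Matrix (Fin 4) (Fin 4) ℝ :=
  Matrix.of fun i j => pderiv i (pderiv j f) r

theorem inner_sub_eq_of_dist {r : Fin 4 → ℝ} {p q : Fin 4 → E3} (hp : IsRealization r p)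
    (hq : IsRealization r q) (i j k : Fin 4) :
    ⟪p j - p i, p k - p i⟫ = ⟪q j - q i, q k - q i⟫ := by
  have hd : ∀ a b, ‖p a - p b‖ = ‖q a - q b‖ := by
    intro a b
    by_cases h : a = b
    · simp [h]
    · rw [← dist_eq_norm, ← dist_eq_norm, hp.dist_eq a b h, hq.dist_eq a b h]
  rw [real_inner_eq_norm_mul_self_add_norm_mul_self_sub_norm_sub_mul_self_div_two,
    real_inner_eq_norm_mul_self_add_norm_mul_self_sub_norm_sub_mul_self_div_two,
    sub_sub_sub_cancel_right, sub_sub_sub_cancel_right, hd, hd, hd]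

theorem inner_starProjection_orthogonal (u v w : E3) :
    ⟪(Submodule.span ℝ {u})ᗮ.starProjection v, (Submodule.span ℝ {u})ᗮ.starProjection w⟫
      = ⟪v, w⟫ - ⟪u, v⟫ * ⟪u, w⟫ / ⟪u, u⟫ := by
  rw [Submodule.inner_starProjection_left_eq_right,
    Submodule.starProjection_eq_self_iff.mpr (Submodule.starProjection_apply_mem _ w),
    Submodule.starProjection_orthogonal_val, Submodule.starProjection_singleton,
    inner_sub_right, real_inner_smul_right, real_inner_self_eq_norm_sq, real_inner_comm v u]
  simp
  ring

theorem dihedralAngle_congr {r : Fin 4 → ℝ} {p q : Fin 4 → E3} (hp : IsRealization r p)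
    (hq : IsRealization r q) (i j k l : Fin 4) :
    dihedralAngle (p i) (p j) (p k) (p l) = dihedralAngle (q i) (q j) (q k) (q l) := by
  simp only [dihedralAngle, InnerProductGeometry.angle, norm_eq_sqrt_real_inner,
    inner_starProjection_orthogonal, inner_sub_eq_of_dist hp hq]

/-- `S_i` may be computed in any realization. -/
theorem solidAngle_eq {r : Fin 4 → ℝ} (hr : ∀ i, 0 < r i) {p : Fin 4 → E3}
    (hp : IsRealization r p) (i : Fin 4) :
    solidAngle i r = vertexSolidAngle (p i) (p (i + 1)) (p (i + 2)) (p (i + 3)) := by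
  have h : r ∈ conformalSet := ⟨hr, p, hp⟩
  have hc := h.2.choose_spec
  simp only [solidAngle, dif_pos h, vertexSolidAngle, dihedralAngle_congr hc hp]

end ConformalSimplex

end

/-!
Write `a, b, c, d` for the radii. The tetrahedron exists exactly when the polynomial `volPoly`
(nine times the squared volume) is positive (`mem_conformalSet_iff`): it is a quarter of the Gram
determinant of the edge vectors, and explicit coordinates realize any radii for which it is
positive. The dihedral angle at an edge is the arccosine of an explicit function of the radii
(`dihedralAngle_eq_edgeAngle`), whose sine is `(a + b) * √volPoly` over a nonvanishing factor; so
the solid angles are smooth functions of the radii.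

Differentiating (`hasDerivAt_vertexAngle`) gives `dSᵢ = ∑_{j ≠ i} gᵢⱼ (drⱼ - (rⱼ / rᵢ) drᵢ)` with
explicit conductances `gᵢⱼ` that are symmetric in `i` and `j`. The symmetry yields Schläfli's formula
`∑ rᵢ dSᵢ = 0`, hence `∂S / ∂rᵢ = Sᵢ` and the Hessian of `S` is the matrix `∂Sᵢ / ∂rⱼ`. Its quadratic
form is `-∑_{i<j} gᵢⱼ rᵢ rⱼ (xᵢ / rᵢ - xⱼ / rⱼ)²`, which vanishes on multiples of `r`.

The `gᵢⱼ` can be negative, so definiteness modulo `r` needs an argument. Put `kᵢ = 1 / rᵢ`,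
`sᵢ = ∑ k - 2 kᵢ` and `Q = (∑ k)² - 2 ∑ k² = ∑ kᵢ sᵢ`, which is `volPoly / (a b c d)²`. Then, up to a
common positive factor, `gᵢⱼ rᵢ rⱼ = nᵢ nⱼ (Q + s_k s_l)` with `nᵢ = kᵢ (Q + sᵢ²)`
(`conductance_mul`). If all `sᵢ` are nonnegative every coefficient is positive. Otherwise exactly one
of them, say `s₄`, is negative. The form then degenerates to rank one as `Q → 0`, which
suggests splitting off the square of the linear form with coefficients `nᵢ / sᵢ`; the remainder is `Q`
times a sum of squares with positive coefficients (`energy_pos_of_neg`, `energy_pos_of_large`).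
-/

noncomputable section

namespace ConformalSimplex

/-! ### Conformal tetrahedra in terms of their radii -/

/-- A quarter of the Gram determinant of the edge vectors at a vertex of the conformal tetrahedron
with radii `a`, `b`, `c`, `d`, that is, nine times its squared volume. -/
def volPoly (a b c d : ℝ) : ℝ :=
  (b * c * d + a * c * d + a * b * d + a * b * c) ^ 2 -
    2 * ((b * c * d) ^ 2 + (a * c * d) ^ 2 + (a * b * d) ^ 2 + (a * b * c) ^ 2)

/-- The numerator of the cosine of the dihedral angle at the edge joining the vertices with radii
`a` and `b`, the other two radii being `c` and `d`. -/
def cosNum (a b c d : ℝ) : ℝ :=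
  a * b * (a + b) * (c + d) - c * d * (a ^ 2 + b ^ 2)

/-- The denominator of the cosine of the dihedral angle. -/
def cosDen (a b c d : ℝ) : ℝ :=
  2 * (a * b) * √(c * d * (a + b + c) * (a + b + d))

/-- The dihedral angle at the edge joining the vertices with radii `a` and `b` of the conformal
tetrahedron with radii `a`, `b`, `c`, `d`. -/
def edgeAngle (a b c d : ℝ) : ℝ :=
  Real.arccos (cosNum a b c d / cosDen a b c d)

theorem inner_edge_edge {r : Fin 4 → ℝ} {p : Fin 4 → E3}
    (h : ∀ i j, i ≠ j → dist (p i) (p j) = r i + r j) {i j k : Fin 4}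
    (hij : i ≠ j) (hik : i ≠ k) (hjk : j ≠ k) :
    ⟪p j - p i, p k - p i⟫ = r i ^ 2 + r i * r j + r i * r k - r j * r k := by
  rw [real_inner_eq_norm_mul_self_add_norm_mul_self_sub_norm_sub_mul_self_div_two,
    sub_sub_sub_cancel_right, ← dist_eq_norm, ← dist_eq_norm, ← dist_eq_norm,
    h j i hij.symm, h k i hik.symm, h j k hjk]
  ring

theorem inner_edge_self {r : Fin 4 → ℝ} {p : Fin 4 → E3}
    (h : ∀ i j, i ≠ j → dist (p i) (p j) = r i + r j) {i j : Fin 4} (hij : i ≠ j) :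
    ⟪p j - p i, p j - p i⟫ = (r i + r j) ^ 2 := by
  rw [real_inner_self_eq_norm_sq, ← dist_eq_norm, h j i hij.symm, add_comm]

theorem det_gram_edges {r : Fin 4 → ℝ} {p : Fin 4 → E3}
    (h : ∀ i j, i ≠ j → dist (p i) (p j) = r i + r j) :
    (Matrix.gram ℝ fun i : Fin 3 => p i.succ - p 0).det =
      4 * volPoly (r 0) (r 1) (r 2) (r 3) := by
  have h01 : (0 : Fin 4) ≠ 1 := by decide
  have h02 : (0 : Fin 4) ≠ 2 := by decide
  have h03 : (0 : Fin 4) ≠ 3 := by decide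
  have h12 : (1 : Fin 4) ≠ 2 := by decide
  have h13 : (1 : Fin 4) ≠ 3 := by decide
  have h23 : (2 : Fin 4) ≠ 3 := by decide
  have e1 : (1 : Fin 3).succ = (2 : Fin 4) := rfl
  have e2 : (2 : Fin 3).succ = (3 : Fin 4) := rfl
  simp only [Matrix.det_fin_three, Matrix.gram_apply, Fin.succ_zero_eq_one, e1, e2,
    inner_edge_self h h01, inner_edge_self h h02, inner_edge_self h h03,
    inner_edge_edge h h01 h02 h12, inner_edge_edge h h02 h01 h12.symm,
    inner_edge_edge h h01 h03 h13, inner_edge_edge h h03 h01 h13.symm,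
    inner_edge_edge h h02 h03 h23, inner_edge_edge h h03 h02 h23.symm, volPoly]
  ring

theorem affineIndependent_iff_edges (p : Fin 4 → E3) :
    AffineIndependent ℝ p ↔ LinearIndependent ℝ fun i : Fin 3 => p i.succ - p 0 := by
  rw [affineIndependent_iff_linearIndependent_vsub ℝ p 0,
    ← linearIndependent_equiv (finSuccAboveEquiv (0 : Fin 4))]
  rfl

theorem volPoly_pos_of_isRealization {r : Fin 4 → ℝ} {p : Fin 4 → E3} (hp : IsRealization r p) :
    0 < volPoly (r 0) (r 1) (r 2) (r 3) := by
  have h := (Matrix.posDef_gram_of_linearIndependent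
    ((affineIndependent_iff_edges p).1 hp.affineIndependent)).det_pos
  rw [det_gram_edges hp.dist_eq] at h
  linarith

/-- Placing the first vertex at the origin, the second on the first coordinate axis and the third
in the first coordinate plane determines the remaining coordinates; those are real because the
Gram minors are positive. -/
theorem exists_isRealization {r : Fin 4 → ℝ} (hr : ∀ i, 0 < r i)
    (hW : 0 < volPoly (r 0) (r 1) (r 2) (r 3)) : ∃ p : Fin 4 → E3, IsRealization r p := by
  obtain ⟨a, ha⟩ : ∃ a, a = r 0 := ⟨_, rfl⟩
  obtain ⟨b, hb⟩ : ∃ a, a = r 1 := ⟨_, rfl⟩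
  obtain ⟨c, hc⟩ : ∃ a, a = r 2 := ⟨_, rfl⟩
  obtain ⟨d, hd⟩ : ∃ a, a = r 3 := ⟨_, rfl⟩
  have a0 : 0 < a := ha ▸ hr 0
  have b0 : 0 < b := hb ▸ hr 1
  have c0 : 0 < c := hc ▸ hr 2
  have d0 : 0 < d := hd ▸ hr 3
  rw [← ha, ← hb, ← hc, ← hd] at hW
  have l0 : 0 < a + b := by positivity
  -- `y` is the distance of the third vertex from the first edge, `z` that of the fourth vertex
  -- from the first face
  obtain ⟨y, y0, hy⟩ : ∃ y : ℝ, 0 < y ∧ y ^ 2 = 4 * a * b * c * (a + b + c) / (a + b) ^ 2 :=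
    ⟨√_, Real.sqrt_pos.2 (by positivity), Real.sq_sqrt (by positivity)⟩
  obtain ⟨z, hz⟩ : ∃ z : ℝ, z ^ 2 = volPoly a b c d / (a * b * c * (a + b + c)) :=
    ⟨√_, Real.sq_sqrt (by positivity)⟩
  obtain ⟨x, hx⟩ : ∃ x : ℝ, x * (a + b) = a ^ 2 + a * b + a * c - b * c :=
    ⟨_, div_mul_cancel₀ _ l0.ne'⟩
  obtain ⟨u, hu⟩ : ∃ u : ℝ, u * (a + b) = a ^ 2 + a * b + a * d - b * d :=
    ⟨_, div_mul_cancel₀ _ l0.ne'⟩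
  obtain ⟨v, hv⟩ : ∃ v : ℝ, v * y = a ^ 2 + a * c + a * d - c * d - x * u :=
    ⟨_, div_mul_cancel₀ _ y0.ne'⟩
  rw [eq_div_iff (by positivity)] at hy hz
  have hxy : x ^ 2 + y ^ 2 = (a + c) ^ 2 := by
    have : (x ^ 2 + y ^ 2) * (a + b) ^ 2 = (a + c) ^ 2 * (a + b) ^ 2 := by
      linear_combination hy + (x * (a + b) + (a ^ 2 + a * b + a * c - b * c)) * hx
    exact mul_right_cancel₀ (by positivity) this
  have huv : u ^ 2 + v ^ 2 + z ^ 2 = (a + d) ^ 2 := by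
    have hx' : x = (a ^ 2 + a * b + a * c - b * c) / (a + b) := eq_div_of_mul_eq l0.ne' hx
    have hu' : u = (a ^ 2 + a * b + a * d - b * d) / (a + b) := eq_div_of_mul_eq l0.ne' hu
    have hv2 : v ^ 2 * (4 * a * b * c * (a + b + c)) =
        (a ^ 2 + a * c + a * d - c * d - x * u) ^ 2 * (a + b) ^ 2 := by
      rw [← hy, ← hv]; ring
    have hz2 : z ^ 2 * (4 * a * b * c * (a + b + c)) = 4 * volPoly a b c d := by
      rw [← hz]; ring
    have hk : (4 * a * b * c * (a + b + c)) ≠ 0 := by positivity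
    apply mul_right_cancel₀ hk
    rw [add_mul, add_mul, hv2, hz2, hx', hu', volPoly]
    field_simp
    ring
  obtain ⟨p, hp⟩ : ∃ p : Fin 4 → E3,
      p = ![!₂[0, 0, 0], !₂[a + b, 0, 0], !₂[x, y, 0], !₂[u, v, z]] := ⟨_, rfl⟩
  have key : ∀ i j : Fin 4, i < j → dist (p i) (p j) = r i + r j := by
    intro i j hij
    rw [EuclideanSpace.dist_eq, Real.sqrt_eq_iff_mul_self_eq_of_pos (add_pos (hr i) (hr j))]
    fin_cases i <;> fin_cases j <;> first | exact absurd hij (by decide) | skip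
    all_goals
      simp [hp, Fin.sum_univ_three, Real.dist_eq, sq_abs, ← ha, ← hb, ← hc, ← hd]
    · ring
    · linear_combination -hxy
    · linear_combination -huv
    · linear_combination -hxy + 2 * hx
    · linear_combination -huv + 2 * hu
    · linear_combination -huv - hxy + 2 * hv
  have hdist : ∀ i j : Fin 4, i ≠ j → dist (p i) (p j) = r i + r j := by
    intro i j hij
    rcases lt_or_gt_of_ne hij with h | h
    · exact key i j h
    · rw [dist_comm, add_comm (r i), key j i h]
  refine ⟨p, ?_, hdist⟩
  rw [affineIndependent_iff_edges, ← Matrix.det_gram_ne_zero_iff_linearIndependent,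
    det_gram_edges hdist, ← ha, ← hb, ← hc, ← hd]
  positivity

theorem mem_conformalSet_iff {r : Fin 4 → ℝ} :
    r ∈ conformalSet ↔ (∀ i, 0 < r i) ∧ 0 < volPoly (r 0) (r 1) (r 2) (r 3) :=
  ⟨fun h => ⟨h.1, h.2.elim fun _ hp => volPoly_pos_of_isRealization hp⟩,
    fun h => ⟨h.1, exists_isRealization h.1 h.2⟩⟩

theorem isOpen_conformalSet : IsOpen conformalSet := by
  have h : conformalSet =
      (⋂ i, {r : Fin 4 → ℝ | 0 < r i}) ∩ {r | 0 < volPoly (r 0) (r 1) (r 2) (r 3)} := by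
    ext r
    simp [mem_conformalSet_iff]
  rw [h]
  refine (isOpen_iInter_of_finite fun i => isOpen_lt (by fun_prop) (by fun_prop)).inter
    (isOpen_lt (by fun_prop) ?_)
  unfold volPoly
  fun_prop

/-! ### The dihedral angles as functions of the radii -/

theorem dihedralAngle_eq_edgeAngle {r : Fin 4 → ℝ} (hr : ∀ i, 0 < r i) {p : Fin 4 → E3}
    (hp : IsRealization r p) {i j k l : Fin 4} (hij : i ≠ j) (hik : i ≠ k) (hil : i ≠ l)
    (hjk : j ≠ k) (hjl : j ≠ l) (hkl : k ≠ l) :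
    dihedralAngle (p i) (p j) (p k) (p l) = edgeAngle (r i) (r j) (r k) (r l) := by
  have hi := hr i
  have hj := hr j
  have hk := hr k
  have hl := hr l
  simp only [dihedralAngle, InnerProductGeometry.angle, norm_eq_sqrt_real_inner,
    inner_starProjection_orthogonal, inner_edge_self hp.dist_eq hij, inner_edge_self hp.dist_eq hik,
    inner_edge_self hp.dist_eq hil, inner_edge_edge hp.dist_eq hij hik hjk,
    inner_edge_edge hp.dist_eq hij hil hjl, inner_edge_edge hp.dist_eq hik hil hkl, edgeAngle]
  generalize r i = a at *
  generalize r j = b at *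
  generalize r k = c at *
  generalize r l = d at *
  have h1 : (a + c) ^ 2 - (a ^ 2 + a * b + a * c - b * c) * (a ^ 2 + a * b + a * c - b * c) /
      (a + b) ^ 2 = (2 / (a + b)) ^ 2 * (a * b * (c * (a + b + c))) := by
    field_simp
    ring
  have h2 : (a + d) ^ 2 - (a ^ 2 + a * b + a * d - b * d) * (a ^ 2 + a * b + a * d - b * d) /
      (a + b) ^ 2 = (2 / (a + b)) ^ 2 * (a * b * (d * (a + b + d))) := by
    field_simp
    ring
  have h3 : a ^ 2 + a * c + a * d - c * d - (a ^ 2 + a * b + a * c - b * c) *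
      (a ^ 2 + a * b + a * d - b * d) / (a + b) ^ 2 = 2 / (a + b) ^ 2 * cosNum a b c d := by
    unfold cosNum
    field_simp
    ring
  rw [h1, h2, h3, ← Real.sqrt_mul (by positivity)]
  have h4 : (2 / (a + b)) ^ 2 * (a * b * (c * (a + b + c))) *
      ((2 / (a + b)) ^ 2 * (a * b * (d * (a + b + d)))) =
      ((2 / (a + b)) ^ 2 * (a * b)) ^ 2 * (c * d * (a + b + c) * (a + b + d)) := by ring
  rw [h4, Real.sqrt_mul (by positivity), Real.sqrt_sq (by positivity), cosDen]
  have : 0 < √(c * d * (a + b + c) * (a + b + d)) := Real.sqrt_pos.2 (by positivity)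
  congr 1
  field_simp

/-- The solid angle at the vertex of radius `a`. -/
def vertexAngle (a b c d : ℝ) : ℝ :=
  -Real.pi + (edgeAngle a b c d + edgeAngle a c b d + edgeAngle a d b c)

theorem solidAngle_eq_vertexAngle {r : Fin 4 → ℝ} (h : r ∈ conformalSet) (i : Fin 4) :
    solidAngle i r = vertexAngle (r i) (r (i + 1)) (r (i + 2)) (r (i + 3)) := by
  obtain ⟨hr, p, hp⟩ := h
  rw [solidAngle_eq hr hp, vertexSolidAngle, vertexAngle]
  have h1 : i ≠ i + 1 := by revert i; decide
  have h2 : i ≠ i + 2 := by revert i; decide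
  have h3 : i ≠ i + 3 := by revert i; decide
  have h12 : i + 1 ≠ i + 2 := by revert i; decide
  have h13 : i + 1 ≠ i + 3 := by revert i; decide
  have h23 : i + 2 ≠ i + 3 := by revert i; decide
  rw [dihedralAngle_eq_edgeAngle hr hp h1 h2 h3 h12 h13 h23,
    dihedralAngle_eq_edgeAngle hr hp h2 h1 h3 h12.symm h23 h13,
    dihedralAngle_eq_edgeAngle hr hp h3 h1 h2 h13.symm h23.symm h12]

/-! ### Derivatives of the solid angles -/

theorem cosDen_pos {a b c d : ℝ} (ha : 0 < a) (hb : 0 < b) (hc : 0 < c) (hd : 0 < d) :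
    0 < cosDen a b c d := by
  unfold cosDen
  have : 0 < √(c * d * (a + b + c) * (a + b + d)) := Real.sqrt_pos.2 (by positivity)
  positivity

/-- Up to the common factor `cosDen a b c d`, the sine of the dihedral angle is
`(a + b) * √(volPoly a b c d)`. -/
theorem cosDen_sq_sub_cosNum_sq {a b c d : ℝ} (ha : 0 < a) (hb : 0 < b) (hc : 0 < c)
    (hd : 0 < d) :
    cosDen a b c d ^ 2 - cosNum a b c d ^ 2 = (a + b) ^ 2 * volPoly a b c d := by
  unfold cosDen cosNum volPoly
  rw [mul_pow, Real.sq_sqrt (by positivity)]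
  ring

theorem one_sub_cos_sq {a b c d : ℝ} (ha : 0 < a) (hb : 0 < b) (hc : 0 < c) (hd : 0 < d) :
    1 - (cosNum a b c d / cosDen a b c d) ^ 2 =
      ((a + b) / cosDen a b c d) ^ 2 * volPoly a b c d := by
  have h := cosDen_pos ha hb hc hd
  have h2 := cosDen_sq_sub_cosNum_sq ha hb hc hd
  field_simp
  exact h2

theorem cos_ne {a b c d : ℝ} (ha : 0 < a) (hb : 0 < b) (hc : 0 < c) (hd : 0 < d)
    (hW : 0 < volPoly a b c d) :
    cosNum a b c d / cosDen a b c d ≠ -1 ∧ cosNum a b c d / cosDen a b c d ≠ 1 := by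
  have h := one_sub_cos_sq ha hb hc hd
  have hD := cosDen_pos ha hb hc hd
  have : 0 < ((a + b) / cosDen a b c d) ^ 2 * volPoly a b c d := by positivity
  constructor <;> intro h1 <;> rw [← h, h1] at this <;> norm_num at this

theorem contDiffAt_edgeAngle {E : Type*} [NormedAddCommGroup E] [NormedSpace ℝ E] {n : WithTop ℕ∞}
    {a b c d : E → ℝ} {x : E} (ha : ContDiffAt ℝ n a x) (hb : ContDiffAt ℝ n b x)
    (hc : ContDiffAt ℝ n c x) (hd : ContDiffAt ℝ n d x) (a0 : 0 < a x) (b0 : 0 < b x)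
    (c0 : 0 < c x) (d0 : 0 < d x) (hW : 0 < volPoly (a x) (b x) (c x) (d x)) :
    ContDiffAt ℝ n (fun x => edgeAngle (a x) (b x) (c x) (d x)) x := by
  obtain ⟨h1, h2⟩ := cos_ne a0 b0 c0 d0 hW
  refine (Real.contDiffAt_arccos h1 h2).comp x
    (f := fun x => cosNum (a x) (b x) (c x) (d x) / cosDen (a x) (b x) (c x) (d x)) ?_
  refine ContDiffAt.div ?_ ?_ (cosDen_pos a0 b0 c0 d0).ne'
  · unfold cosNum
    fun_prop
  · unfold cosDen
    refine ContDiffAt.mul (by fun_prop) (ContDiffAt.sqrt (by fun_prop) ?_)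
    positivity

/-- The differential of a dihedral angle. -/
theorem hasDerivAt_edgeAngle {a b c d : ℝ → ℝ} {a' b' c' d' t : ℝ} (ha : HasDerivAt a a' t)
    (hb : HasDerivAt b b' t) (hc : HasDerivAt c c' t) (hd : HasDerivAt d d' t) (a0 : 0 < a t)
    (b0 : 0 < b t) (c0 : 0 < c t) (d0 : 0 < d t) (hW : 0 < volPoly (a t) (b t) (c t) (d t)) :
    HasDerivAt (fun t => edgeAngle (a t) (b t) (c t) (d t))
      (-((a' * b t + a t * b') * (a t + b t) * (c t + d t) +
          a t * b t * (a' + b') * (c t + d t) + a t * b t * (a t + b t) * (c' + d') -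
          (c' * d t + c t * d') * (a t ^ 2 + b t ^ 2) -
          c t * d t * (2 * a t * a' + 2 * b t * b') -
        cosNum (a t) (b t) (c t) (d t) * (a' / a t + b' / b t +
          (c' / c t + d' / d t + (a' + b' + c') / (a t + b t + c t) +
            (a' + b' + d') / (a t + b t + d t)) / 2)) /
        ((a t + b t) * √(volPoly (a t) (b t) (c t) (d t)))) t := by
  obtain ⟨h1, h2⟩ := cos_ne a0 b0 c0 d0 hW
  have hP : 0 < c t * d t * (a t + b t + c t) * (a t + b t + d t) := by positivity
  have hD := cosDen_pos a0 b0 c0 d0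
  have hNum : HasDerivAt (fun t => cosNum (a t) (b t) (c t) (d t)) _ t :=
    (((ha.mul hb).mul (ha.add hb)).mul (hc.add hd)).sub
      ((hc.mul hd).mul ((ha.pow 2).add (hb.pow 2)))
  have hDen : HasDerivAt (fun t => cosDen (a t) (b t) (c t) (d t)) _ t :=
    ((ha.mul hb).const_mul 2).mul
      ((((hc.mul hd).mul ((ha.add hb).add hc)).mul ((ha.add hb).add hd)).sqrt hP.ne')
  have hq := hNum.div hDen hD.ne'
  have h := (Real.hasDerivAt_arccos h1 h2).comp t hq
  refine h.congr_deriv ?_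
  rw [one_sub_cos_sq a0 b0 c0 d0, Real.sqrt_mul (by positivity), Real.sqrt_sq (by positivity)]
  have hS : 0 < √(volPoly (a t) (b t) (c t) (d t)) := Real.sqrt_pos.2 hW
  simp only [Pi.mul_apply, Pi.add_apply, cosDen] at hD ⊢
  have hR := Real.sqrt_pos.2 hP
  have hR2 := Real.sq_sqrt hP.le
  generalize √(volPoly (a t) (b t) (c t) (d t)) = S at *
  generalize √(c t * d t * (a t + b t + c t) * (a t + b t + d t)) = R at *
  generalize cosNum (a t) (b t) (c t) (d t) = N at *
  -- the logarithmic derivative of the radicand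
  have key : (((c' * d t + c t * d') * (a t + b t + c t) + c t * d t * (a' + b' + c')) *
      (a t + b t + d t) + c t * d t * (a t + b t + c t) * (a' + b' + d')) / (2 * R) =
      R * ((c' / c t + d' / d t + (a' + b' + c') / (a t + b t + c t) +
        (a' + b' + d') / (a t + b t + d t)) / 2) := by
    rw [div_eq_iff (by positivity)]
    have e : ∀ L : ℝ, R * (L / 2) * (2 * R) = R ^ 2 * L := fun L => by ring
    rw [e, hR2]
    field_simp
  rw [key]
  generalize (c' / c t + d' / d t + (a' + b' + c') / (a t + b t + c t) +
    (a' + b' + d') / (a t + b t + d t)) / 2 = L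
  clear hNum hDen hq h key hR2 hP
  push_cast
  field_simp
  ring

/-- The coefficient with which the radius of an adjacent vertex enters the differential of a solid
angle: the partial derivative in `b` of the solid angle at the vertex of radius `a`. -/
def conductance (a b c d : ℝ) : ℝ :=
  (c * d * ((a + b) * (c + d) + 2 * c * d) - a * b * (c - d) ^ 2) /
    ((a + b + c) * (a + b + d) * √(volPoly a b c d))

theorem volPoly_comm₂₃ (a b c d : ℝ) : volPoly a c b d = volPoly a b c d := by
  unfold volPoly; ring

theorem volPoly_rotate (a b c d : ℝ) : volPoly a d b c = volPoly a b c d := by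
  unfold volPoly; ring

theorem hasDerivAt_vertexAngle {a b c d : ℝ → ℝ} {a' b' c' d' t : ℝ} (ha : HasDerivAt a a' t)
    (hb : HasDerivAt b b' t) (hc : HasDerivAt c c' t) (hd : HasDerivAt d d' t) (a0 : 0 < a t)
    (b0 : 0 < b t) (c0 : 0 < c t) (d0 : 0 < d t) (hW : 0 < volPoly (a t) (b t) (c t) (d t)) :
    HasDerivAt (fun t => vertexAngle (a t) (b t) (c t) (d t))
      (conductance (a t) (b t) (c t) (d t) * (b' - b t / a t * a') +
        conductance (a t) (c t) (b t) (d t) * (c' - c t / a t * a') +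
        conductance (a t) (d t) (b t) (c t) * (d' - d t / a t * a')) t := by
  have h := (((hasDerivAt_edgeAngle ha hb hc hd a0 b0 c0 d0 hW).add
    (hasDerivAt_edgeAngle ha hc hb hd a0 c0 b0 d0 (by rwa [volPoly_comm₂₃]))).add
    (hasDerivAt_edgeAngle ha hd hb hc a0 d0 b0 c0 (by rwa [volPoly_rotate]))).const_add (-Real.pi)
  refine h.congr_deriv ?_
  have hS : 0 < √(volPoly (a t) (b t) (c t) (d t)) := Real.sqrt_pos.2 hW
  -- the remaining identity is rational in the radii, with the square root as a common factor
  simp only [conductance, volPoly_comm₂₃ (a t) (b t) (c t), volPoly_rotate (a t) (b t), cosNum]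
  clear h hW ha hb hc hd
  generalize √(volPoly (a t) (b t) (c t) (d t)) = S at *
  generalize a t = a at *
  generalize b t = b at *
  generalize c t = c at *
  generalize d t = d at *
  field_simp
  ring

/-! ### Positivity of the quadratic form -/

/-- The quadratic form `∑_{i<j} nᵢ nⱼ (Q + s_k s_l) (yᵢ - yⱼ)²`, where `{i, j, k, l}` is the set of
all four indices. -/
def energy (Q s₁ s₂ s₃ s₄ n₁ n₂ n₃ n₄ y₁ y₂ y₃ y₄ : ℝ) : ℝ :=
  n₁ * n₂ * (Q + s₃ * s₄) * (y₁ - y₂) ^ 2 + n₁ * n₃ * (Q + s₂ * s₄) * (y₁ - y₃) ^ 2 +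
  n₁ * n₄ * (Q + s₂ * s₃) * (y₁ - y₄) ^ 2 + n₂ * n₃ * (Q + s₁ * s₄) * (y₂ - y₃) ^ 2 +
  n₂ * n₄ * (Q + s₁ * s₃) * (y₂ - y₄) ^ 2 + n₃ * n₄ * (Q + s₁ * s₂) * (y₃ - y₄) ^ 2

theorem energy_pos_of_nonneg {Q s₁ s₂ s₃ s₄ n₁ n₂ n₃ n₄ : ℝ} (hQ : 0 < Q) (hs₁ : 0 ≤ s₁)
    (hs₂ : 0 ≤ s₂) (hs₃ : 0 ≤ s₃) (hs₄ : 0 ≤ s₄) (hn₁ : 0 < n₁) (hn₂ : 0 < n₂) (hn₃ : 0 < n₃)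
    (hn₄ : 0 < n₄) (y₁ y₂ y₃ y₄ : ℝ) (hy : ¬(y₁ = y₄ ∧ y₂ = y₄ ∧ y₃ = y₄)) :
    0 < energy Q s₁ s₂ s₃ s₄ n₁ n₂ n₃ n₄ y₁ y₂ y₃ y₄ := by
  unfold energy
  by_cases h1 : y₁ = y₄
  · by_cases h2 : y₂ = y₄
    · have h3 : y₃ - y₄ ≠ 0 := fun h => hy ⟨h1, h2, sub_eq_zero.1 h⟩
      positivity
    · have h2 : y₂ - y₄ ≠ 0 := sub_ne_zero.2 h2
      positivity
  · have h1 : y₁ - y₄ ≠ 0 := sub_ne_zero.2 h1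
    positivity

/-- If `s₄ < 0`, the form is a positive multiple of the square of a linear form, plus `Q` times a
form that is visibly positive definite modulo constants. The hypothesis `h` says that `s₁ s₂ s₃ s₄ ∑ nᵢ / sᵢ = Q θ`. -/
theorem energy_pos_of_neg {Q s₁ s₂ s₃ s₄ n₁ n₂ n₃ n₄ θ : ℝ} (hQ : 0 < Q) (hs₁ : 0 < s₁)
    (hs₂ : 0 < s₂) (hs₃ : 0 < s₃) (hs₄ : s₄ < 0) (hn₁ : 0 < n₁) (hn₂ : 0 < n₂) (hn₃ : 0 < n₃)
    (hn₄ : 0 < n₄) (hθ : 0 < θ)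
    (h : n₁ * s₂ * s₃ * s₄ + s₁ * n₂ * s₃ * s₄ + s₁ * s₂ * n₃ * s₄ + s₁ * s₂ * s₃ * n₄ = Q * θ)
    (y₁ y₂ y₃ y₄ : ℝ) (hy : ¬(y₁ = y₄ ∧ y₂ = y₄ ∧ y₃ = y₄)) :
    0 < energy Q s₁ s₂ s₃ s₄ n₁ n₂ n₃ n₄ y₁ y₂ y₃ y₄ := by
  have e : energy Q s₁ s₂ s₃ s₄ n₁ n₂ n₃ n₄ y₁ y₂ y₃ y₄ =
      s₁ * s₂ * s₃ * (-s₄) *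
        (n₁ / s₁ * (y₁ - y₄) + n₂ / s₂ * (y₂ - y₄) + n₃ / s₃ * (y₃ - y₄)) ^ 2 +
      Q * (n₁ * n₂ * (y₁ - y₂) ^ 2 + n₁ * n₃ * (y₁ - y₃) ^ 2 + n₂ * n₃ * (y₂ - y₃) ^ 2) +
      Q * (n₁ * (n₄ + θ / s₁) * (y₁ - y₄) ^ 2 + n₂ * (n₄ + θ / s₂) * (y₂ - y₄) ^ 2 +
        n₃ * (n₄ + θ / s₃) * (y₃ - y₄) ^ 2) := by
    obtain rfl : θ = (n₁ * s₂ * s₃ * s₄ + s₁ * n₂ * s₃ * s₄ + s₁ * s₂ * n₃ * s₄ +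
        s₁ * s₂ * s₃ * n₄) / Q := by rw [h]; field_simp
    unfold energy
    field_simp
    ring
  rw [e]
  have hs₄' : 0 < -s₄ := neg_pos.2 hs₄
  by_cases h1 : y₁ = y₄
  · by_cases h2 : y₂ = y₄
    · have h3 : y₃ - y₄ ≠ 0 := fun h => hy ⟨h1, h2, sub_eq_zero.1 h⟩
      positivity
    · have h2 : y₂ - y₄ ≠ 0 := sub_ne_zero.2 h2
      positivity
  · have h1 : y₁ - y₄ ≠ 0 := sub_ne_zero.2 h1
    positivity

/-- The case of four curvatures `kᵢ` of which the last exceeds the sum of the others. -/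
theorem energy_pos_of_large {Q k₁ k₂ k₃ k₄ s₁ s₂ s₃ s₄ : ℝ} (h₁ : 0 < k₁) (h₂ : 0 < k₂)
    (h₃ : 0 < k₃) (h₄ : 0 < k₄) (hQ : 0 < Q) (hs₁ : s₁ = k₂ + k₃ + k₄ - k₁)
    (hs₂ : s₂ = k₁ + k₃ + k₄ - k₂) (hs₃ : s₃ = k₁ + k₂ + k₄ - k₃) (hs₄ : s₄ = k₁ + k₂ + k₃ - k₄)
    (hQe : Q = k₁ * s₁ + k₂ * s₂ + k₃ * s₃ + k₄ * s₄) (hneg : s₄ < 0)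
    (y₁ y₂ y₃ y₄ : ℝ) (hy : ¬(y₁ = y₄ ∧ y₂ = y₄ ∧ y₃ = y₄)) :
    0 < energy Q s₁ s₂ s₃ s₄ (k₁ * (Q + s₁ ^ 2)) (k₂ * (Q + s₂ ^ 2)) (k₃ * (Q + s₃ ^ 2))
      (k₄ * (Q + s₄ ^ 2)) y₁ y₂ y₃ y₄ := by
  have p₁ : 0 < s₁ := by linarith
  have p₂ : 0 < s₂ := by linarith
  have p₃ : 0 < s₃ := by linarith
  refine energy_pos_of_neg hQ p₁ p₂ p₃ hneg (by positivity) (by positivity)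
    (by positivity) (by positivity)
    -- `θ` is `s₁ s₂ s₃ s₄ (1 + ∑ kᵢ / sᵢ)`; it is positive because `sᵢ + s₄ = 2 (kⱼ + k_l)` for
    -- `{i, j, l} = {1, 2, 3}`
    (θ := s₁ * s₂ * s₃ * s₄ + k₁ * s₂ * s₃ * s₄ + s₁ * k₂ * s₃ * s₄ + s₁ * s₂ * k₃ * s₄ +
      s₁ * s₂ * s₃ * k₄) ?_ ?_ y₁ y₂ y₃ y₄ hy
  · have e : s₁ * s₂ * s₃ * s₄ + k₁ * s₂ * s₃ * s₄ + s₁ * k₂ * s₃ * s₄ + s₁ * s₂ * k₃ * s₄ +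
        s₁ * s₂ * s₃ * k₄ = 2 * (k₁ * (k₂ + k₃) * s₂ * s₃ + k₂ * (k₁ + k₃) * s₁ * s₃ +
          k₃ * (k₁ + k₂) * s₁ * s₂) := by
      subst hs₁ hs₂ hs₃ hs₄
      ring
    rw [e]
    positivity
  · linear_combination -s₁ * s₂ * s₃ * s₄ * hQe

theorem energy_pos {Q k₁ k₂ k₃ k₄ s₁ s₂ s₃ s₄ : ℝ} (h₁ : 0 < k₁) (h₂ : 0 < k₂)
    (h₃ : 0 < k₃) (h₄ : 0 < k₄) (hQ : 0 < Q) (hs₁ : s₁ = k₂ + k₃ + k₄ - k₁)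
    (hs₂ : s₂ = k₁ + k₃ + k₄ - k₂) (hs₃ : s₃ = k₁ + k₂ + k₄ - k₃) (hs₄ : s₄ = k₁ + k₂ + k₃ - k₄)
    (hQe : Q = k₁ * s₁ + k₂ * s₂ + k₃ * s₃ + k₄ * s₄)
    (y₁ y₂ y₃ y₄ : ℝ) (hy : ¬(y₁ = y₄ ∧ y₂ = y₄ ∧ y₃ = y₄)) :
    0 < energy Q s₁ s₂ s₃ s₄ (k₁ * (Q + s₁ ^ 2)) (k₂ * (Q + s₂ ^ 2)) (k₃ * (Q + s₃ ^ 2))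
      (k₄ * (Q + s₄ ^ 2)) y₁ y₂ y₃ y₄ := by
  rcases lt_or_ge s₄ 0 with c₄ | c₄
  · exact energy_pos_of_large h₁ h₂ h₃ h₄ hQ hs₁ hs₂ hs₃ hs₄ hQe c₄ y₁ y₂ y₃ y₄ hy
  rcases lt_or_ge s₃ 0 with c₃ | c₃
  · refine (energy_pos_of_large (s₁ := s₁) (s₂ := s₂) h₁ h₂ h₄ h₃ hQ
      (by linarith) (by linarith) (by linarith) (by linarith) (by linarith) c₃ y₁ y₂ y₄ y₃
      fun h => hy ⟨h.1.trans h.2.2.symm, h.2.1.trans h.2.2.symm, h.2.2.symm⟩).trans_eq ?_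
    unfold energy; ring
  rcases lt_or_ge s₂ 0 with c₂ | c₂
  · refine (energy_pos_of_large (s₁ := s₁) (s₃ := s₃) h₁ h₄ h₃ h₂ hQ
      (by linarith) (by linarith) (by linarith) (by linarith) (by linarith) c₂ y₁ y₄ y₃ y₂
      fun h => hy ⟨h.1.trans h.2.1.symm, h.2.1.symm, h.2.2.trans h.2.1.symm⟩).trans_eq ?_
    unfold energy; ring
  rcases lt_or_ge s₁ 0 with c₁ | c₁
  · refine (energy_pos_of_large (s₂ := s₂) (s₃ := s₃) h₄ h₂ h₃ h₁ hQ
      (by linarith) (by linarith) (by linarith) (by linarith) (by linarith) c₁ y₄ y₂ y₃ y₁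
      fun h => hy ⟨h.1.symm, h.2.1.trans h.1.symm, h.2.2.trans h.1.symm⟩).trans_eq ?_
    unfold energy; ring
  exact energy_pos_of_nonneg hQ c₁ c₂ c₃ c₄ (by positivity) (by positivity) (by positivity)
    (by positivity) y₁ y₂ y₃ y₄ hy

/-- `conductance a b c d * (a * b)` in terms of the curvatures `1 / a`, `1 / b`, `1 / c`, `1 / d`,
where `s_a = 1 / b + 1 / c + 1 / d - 1 / a` and so on. -/
theorem conductance_mul {a b c d sa sb sc sd Q κ : ℝ} (ha : 0 < a) (hb : 0 < b) (hc : 0 < c)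
    (hd : 0 < d) (hW : 0 < volPoly a b c d) (hsa : sa = 1 / b + 1 / c + 1 / d - 1 / a)
    (hsb : sb = 1 / a + 1 / c + 1 / d - 1 / b) (hsc : sc = 1 / a + 1 / b + 1 / d - 1 / c)
    (hsd : sd = 1 / a + 1 / b + 1 / c - 1 / d)
    (hQ : Q = volPoly a b c d / (a * b * c * d) ^ 2)
    (hκ : κ = (a * b * c * d) ^ 4 / (32 * ((b + c + d) * (a + c + d) * (a + b + d) * (a + b + c)) *
      √(volPoly a b c d))) :
    conductance a b c d * (a * b) =
      κ * (1 / a * (Q + sa ^ 2) * (1 / b * (Q + sb ^ 2)) * (Q + sc * sd)) := by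
  have e1 : Q + sc * sd = 2 * (c * d * ((a + b) * (c + d) + 2 * c * d) - a * b * (c - d) ^ 2) /
      (a * b * c ^ 2 * d ^ 2) := by
    rw [hQ, hsc, hsd, volPoly]
    field_simp
    ring
  have e2 : 1 / a * (Q + sa ^ 2) = 4 * (b + c + d) / (a * b * c * d) := by
    rw [hQ, hsa, volPoly]
    field_simp
    ring
  have e3 : 1 / b * (Q + sb ^ 2) = 4 * (a + c + d) / (a * b * c * d) := by
    rw [hQ, hsb, volPoly]
    field_simp
    ring
  have hS : 0 < √(volPoly a b c d) := Real.sqrt_pos.2 hW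
  rw [e1, e2, e3, hκ, conductance]
  field_simp
  ring

/-- The form `∑_{i<j} gᵢⱼ rᵢ rⱼ (xᵢ / rᵢ - xⱼ / rⱼ)²`, with `gᵢⱼ` the conductances, at the radii
`a, b, c, d` and the vector `(x, y, z, w)`. It is minus the quadratic form of the Hessian. -/
def dirichletForm (a b c d x y z w : ℝ) : ℝ :=
  conductance a b c d * (a * b) * (x / a - y / b) ^ 2 +
  conductance a c b d * (a * c) * (x / a - z / c) ^ 2 +
  conductance a d b c * (a * d) * (x / a - w / d) ^ 2 +
  conductance b c a d * (b * c) * (y / b - z / c) ^ 2 +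
  conductance b d a c * (b * d) * (y / b - w / d) ^ 2 +
  conductance c d a b * (c * d) * (z / c - w / d) ^ 2

theorem dirichletForm_pos {a b c d : ℝ} (ha : 0 < a) (hb : 0 < b) (hc : 0 < c)
    (hd : 0 < d) (hW : 0 < volPoly a b c d) (x y z w : ℝ)
    (h : ¬(x / a = w / d ∧ y / b = w / d ∧ z / c = w / d)) :
    0 < dirichletForm a b c d x y z w := by
  obtain ⟨sa, hsa⟩ : ∃ s, s = 1 / b + 1 / c + 1 / d - 1 / a := ⟨_, rfl⟩
  obtain ⟨sb, hsb⟩ : ∃ s, s = 1 / a + 1 / c + 1 / d - 1 / b := ⟨_, rfl⟩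
  obtain ⟨sc, hsc⟩ : ∃ s, s = 1 / a + 1 / b + 1 / d - 1 / c := ⟨_, rfl⟩
  obtain ⟨sd, hsd⟩ : ∃ s, s = 1 / a + 1 / b + 1 / c - 1 / d := ⟨_, rfl⟩
  obtain ⟨Q, hQ⟩ : ∃ q, q = volPoly a b c d / (a * b * c * d) ^ 2 := ⟨_, rfl⟩
  have w1 : volPoly a c b d = volPoly a b c d := by unfold volPoly; ring
  have w2 : volPoly a d b c = volPoly a b c d := by unfold volPoly; ring
  have w3 : volPoly b c a d = volPoly a b c d := by unfold volPoly; ring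
  have w4 : volPoly b d a c = volPoly a b c d := by unfold volPoly; ring
  have w5 : volPoly c d a b = volPoly a b c d := by unfold volPoly; ring
  have Q0 : 0 < Q := by rw [hQ]; positivity
  have hQe : Q = 1 / a * sa + 1 / b * sb + 1 / c * sc + 1 / d * sd := by
    rw [hQ, hsa, hsb, hsc, hsd, volPoly]
    field_simp
    ring
  have hS : 0 < √(volPoly a b c d) := Real.sqrt_pos.2 hW
  have hE := energy_pos (one_div_pos.2 ha) (one_div_pos.2 hb) (one_div_pos.2 hc)
    (one_div_pos.2 hd) Q0 hsa hsb hsc hsd hQe (x / a) (y / b) (z / c) (w / d) h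
  obtain ⟨κ, hκ⟩ : ∃ κ, κ = (a * b * c * d) ^ 4 / (32 * ((b + c + d) * (a + c + d) * (a + b + d) *
      (a + b + c)) * √(volPoly a b c d)) := ⟨_, rfl⟩
  have hκ₀ : 0 < κ := by rw [hκ]; positivity
  refine (mul_pos hκ₀ hE).trans_eq ?_
  rw [dirichletForm, energy,
    conductance_mul ha hb hc hd hW hsa hsb hsc hsd hQ hκ,
    conductance_mul (sa := sa) (sb := sc) (sc := sb) (sd := sd) (Q := Q) (κ := κ) ha hc hb hd
      (by rwa [w1])
      (by linarith) (by linarith) (by linarith) (by linarith) (by rw [w1, hQ]; ring)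
      (by rw [w1, hκ]; ring),
    conductance_mul (sa := sa) (sb := sd) (sc := sb) (sd := sc) (Q := Q) (κ := κ) ha hd hb hc
      (by rwa [w2])
      (by linarith) (by linarith) (by linarith) (by linarith) (by rw [w2, hQ]; ring)
      (by rw [w2, hκ]; ring),
    conductance_mul (sa := sb) (sb := sc) (sc := sa) (sd := sd) (Q := Q) (κ := κ) hb hc ha hd
      (by rwa [w3])
      (by linarith) (by linarith) (by linarith) (by linarith) (by rw [w3, hQ]; ring)
      (by rw [w3, hκ]; ring),
    conductance_mul (sa := sb) (sb := sd) (sc := sa) (sd := sc) (Q := Q) (κ := κ) hb hd ha hc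
      (by rwa [w4])
      (by linarith) (by linarith) (by linarith) (by linarith) (by rw [w4, hQ]; ring)
      (by rw [w4, hκ]; ring),
    conductance_mul (sa := sc) (sb := sd) (sc := sa) (sd := sb) (Q := Q) (κ := κ) hc hd ha hb
      (by rwa [w5])
      (by linarith) (by linarith) (by linarith) (by linarith) (by rw [w5, hQ]; ring)
      (by rw [w5, hκ]; ring)]
  ring

/-! ### The Hessian -/

theorem conductance_swap (a b c d : ℝ) : conductance b a c d = conductance a b c d := by
  have : volPoly b a c d = volPoly a b c d := by unfold volPoly; ring
  rw [conductance, conductance, this]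
  congr 1 <;> ring

theorem conductance_swap' (a b c d : ℝ) : conductance a b d c = conductance a b c d := by
  have : volPoly a b d c = volPoly a b c d := by unfold volPoly; ring
  rw [conductance, conductance, this]
  congr 1 <;> ring

/-- The differential of the solid angle at the vertex `i` at the point `r`, applied to `v`. As in
`solidAngle`, the other vertices are `i + 1`, `i + 2`, `i + 3` modulo `4`. -/
def solidAngleDeriv (i : Fin 4) (r v : Fin 4 → ℝ) : ℝ :=
  conductance (r i) (r (i + 1)) (r (i + 2)) (r (i + 3)) * (v (i + 1) - r (i + 1) / r i * v i) +
  conductance (r i) (r (i + 2)) (r (i + 1)) (r (i + 3)) * (v (i + 2) - r (i + 2) / r i * v i) +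
  conductance (r i) (r (i + 3)) (r (i + 1)) (r (i + 2)) * (v (i + 3) - r (i + 3) / r i * v i)

theorem volPoly_pos {r : Fin 4 → ℝ} (h : r ∈ conformalSet) (i : Fin 4) :
    0 < volPoly (r i) (r (i + 1)) (r (i + 2)) (r (i + 3)) := by
  refine (mem_conformalSet_iff.1 h).2.trans_eq ?_
  fin_cases i <;> simp [volPoly] <;> ring

theorem contDiffAt_solidAngle {r : Fin 4 → ℝ} (h : r ∈ conformalSet) (i : Fin 4)
    {n : WithTop ℕ∞} : ContDiffAt ℝ n (solidAngle i) r := by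
  have hr := h.1
  have hW := volPoly_pos h i
  have hc : ∀ j, ContDiffAt ℝ n (fun r : Fin 4 → ℝ => r j) r :=
    fun j => (contDiff_apply ℝ ℝ j).contDiffAt
  have h1 := contDiffAt_edgeAngle (hc i) (hc (i + 1)) (hc (i + 2)) (hc (i + 3)) (hr _) (hr _)
    (hr _) (hr _) hW
  have h2 := contDiffAt_edgeAngle (hc i) (hc (i + 2)) (hc (i + 1)) (hc (i + 3)) (hr _) (hr _)
    (hr _) (hr _) (by rwa [volPoly_comm₂₃])
  have h3 := contDiffAt_edgeAngle (hc i) (hc (i + 3)) (hc (i + 1)) (hc (i + 2)) (hr _) (hr _)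
    (hr _) (hr _) (by rwa [volPoly_rotate])
  have : ContDiffAt ℝ n (fun r : Fin 4 → ℝ =>
      vertexAngle (r i) (r (i + 1)) (r (i + 2)) (r (i + 3))) r :=
    contDiffAt_const.add ((h1.add h2).add h3)
  refine this.congr_of_eventuallyEq ?_
  filter_upwards [isOpen_conformalSet.mem_nhds h] with s hs
  exact solidAngle_eq_vertexAngle hs i

theorem differentiableAt_solidAngle {r : Fin 4 → ℝ} (h : r ∈ conformalSet) (i : Fin 4) :
    DifferentiableAt ℝ (solidAngle i) r :=
  (contDiffAt_solidAngle (n := 1) h i).differentiableAt one_ne_zero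

theorem fderiv_solidAngle {r : Fin 4 → ℝ} (h : r ∈ conformalSet) (i : Fin 4) (v : Fin 4 → ℝ) :
    fderiv ℝ (solidAngle i) r v = solidAngleDeriv i r v := by
  -- both sides are the derivative along the line `t ↦ r + t v`
  have hl : HasDerivAt (fun t : ℝ => r + t • v) v 0 := by
    simpa using ((hasDerivAt_id (0 : ℝ)).smul_const v).const_add r
  have hc : ∀ j, HasDerivAt (fun t : ℝ => (r + t • v) j) (v j) 0 := hasDerivAt_pi.1 hl
  have h0 : ∀ j, (r + (0 : ℝ) • v) j = r j := by simp
  have h1 : HasDerivAt (fun t : ℝ => solidAngle i (r + t • v)) (fderiv ℝ (solidAngle i) r v) 0 := by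
    have h' : HasFDerivAt (solidAngle i) (fderiv ℝ (solidAngle i) r) (r + (0 : ℝ) • v) := by
      simpa using (differentiableAt_solidAngle h i).hasFDerivAt
    exact h'.comp_hasDerivAt (0 : ℝ) hl
  have h2 := hasDerivAt_vertexAngle (hc i) (hc (i + 1)) (hc (i + 2)) (hc (i + 3))
    (by rw [h0]; exact h.1 _) (by rw [h0]; exact h.1 _) (by rw [h0]; exact h.1 _)
    (by rw [h0]; exact h.1 _) (by simp only [h0]; exact volPoly_pos h i)
  simp only [h0] at h2
  refine h1.unique (h2.congr_of_eventuallyEq ?_)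
  have : ∀ᶠ t in nhds (0 : ℝ), r + t • v ∈ conformalSet :=
    hl.continuousAt.eventually_mem (by simpa using isOpen_conformalSet.mem_nhds h)
  filter_upwards [this] with t ht
  exact solidAngle_eq_vertexAngle ht i

/-- With the six conductances brought to a common form, the bilinear form given by the derivatives
of the solid angles is visibly symmetric. -/
theorem sum_mul_solidAngleDeriv (r x v : Fin 4 → ℝ) :
    ∑ i, x i * solidAngleDeriv i r v =
      conductance (r 0) (r 1) (r 2) (r 3) *
        (x 0 * v 1 + x 1 * v 0 - r 1 / r 0 * (x 0 * v 0) - r 0 / r 1 * (x 1 * v 1)) +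
      conductance (r 0) (r 2) (r 1) (r 3) *
        (x 0 * v 2 + x 2 * v 0 - r 2 / r 0 * (x 0 * v 0) - r 0 / r 2 * (x 2 * v 2)) +
      conductance (r 0) (r 3) (r 1) (r 2) *
        (x 0 * v 3 + x 3 * v 0 - r 3 / r 0 * (x 0 * v 0) - r 0 / r 3 * (x 3 * v 3)) +
      conductance (r 1) (r 2) (r 0) (r 3) *
        (x 1 * v 2 + x 2 * v 1 - r 2 / r 1 * (x 1 * v 1) - r 1 / r 2 * (x 2 * v 2)) +
      conductance (r 1) (r 3) (r 0) (r 2) *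
        (x 1 * v 3 + x 3 * v 1 - r 3 / r 1 * (x 1 * v 1) - r 1 / r 3 * (x 3 * v 3)) +
      conductance (r 2) (r 3) (r 0) (r 1) *
        (x 2 * v 3 + x 3 * v 2 - r 3 / r 2 * (x 2 * v 2) - r 2 / r 3 * (x 3 * v 3)) := by
  have e0 : solidAngleDeriv 0 r v =
      conductance (r 0) (r 1) (r 2) (r 3) * (v 1 - r 1 / r 0 * v 0) +
      conductance (r 0) (r 2) (r 1) (r 3) * (v 2 - r 2 / r 0 * v 0) +
      conductance (r 0) (r 3) (r 1) (r 2) * (v 3 - r 3 / r 0 * v 0) := rfl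
  have e1 : solidAngleDeriv 1 r v =
      conductance (r 1) (r 2) (r 3) (r 0) * (v 2 - r 2 / r 1 * v 1) +
      conductance (r 1) (r 3) (r 2) (r 0) * (v 3 - r 3 / r 1 * v 1) +
      conductance (r 1) (r 0) (r 2) (r 3) * (v 0 - r 0 / r 1 * v 1) := rfl
  have e2 : solidAngleDeriv 2 r v =
      conductance (r 2) (r 3) (r 0) (r 1) * (v 3 - r 3 / r 2 * v 2) +
      conductance (r 2) (r 0) (r 3) (r 1) * (v 0 - r 0 / r 2 * v 2) +
      conductance (r 2) (r 1) (r 3) (r 0) * (v 1 - r 1 / r 2 * v 2) := rfl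
  have e3 : solidAngleDeriv 3 r v =
      conductance (r 3) (r 0) (r 1) (r 2) * (v 0 - r 0 / r 3 * v 3) +
      conductance (r 3) (r 1) (r 0) (r 2) * (v 1 - r 1 / r 3 * v 3) +
      conductance (r 3) (r 2) (r 0) (r 1) * (v 2 - r 2 / r 3 * v 3) := rfl
  rw [Fin.sum_univ_four, e0, e1, e2, e3,
    conductance_swap (r 0) (r 1), conductance_swap (r 0) (r 2) (r 3), conductance_swap (r 0) (r 3),
    conductance_swap (r 1) (r 2), conductance_swap (r 1) (r 3), conductance_swap (r 2) (r 3),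
    conductance_swap' (r 1) (r 2) (r 0), conductance_swap' (r 1) (r 3) (r 0),
    conductance_swap' (r 0) (r 2) (r 1)]
  ring

theorem solidAngleDeriv_eq_sum (i : Fin 4) (r v : Fin 4 → ℝ) :
    solidAngleDeriv i r v = ∑ k, (Pi.single i 1 : Fin 4 → ℝ) k * solidAngleDeriv k r v := by
  simp [Pi.single_apply]

/-- The matrix of first derivatives of the solid angles is symmetric. -/
theorem solidAngleDeriv_single_comm (r : Fin 4 → ℝ) (i j : Fin 4) :
    solidAngleDeriv i r (Pi.single j 1) = solidAngleDeriv j r (Pi.single i 1) := by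
  rw [solidAngleDeriv_eq_sum, solidAngleDeriv_eq_sum j, sum_mul_solidAngleDeriv,
    sum_mul_solidAngleDeriv]
  ring

/-- Schläfli's formula for conformal tetrahedra. -/
theorem sum_radius_mul_solidAngleDeriv {r : Fin 4 → ℝ} (hr : ∀ i, 0 < r i) (v : Fin 4 → ℝ) :
    ∑ i, r i * solidAngleDeriv i r v = 0 := by
  have h := fun i => (hr i).ne'
  have e : ∀ i j, r i * v j + r j * v i - r j / r i * (r i * v i) - r i / r j * (r j * v j) = 0 := by
    intro i j
    have := h i
    have := h j
    field_simp
    ring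
  rw [sum_mul_solidAngleDeriv]
  simp only [e, mul_zero, add_zero]

/-- Solid angles are invariant under scaling. -/
theorem solidAngleDeriv_self {r : Fin 4 → ℝ} (hr : ∀ i, 0 < r i) (i : Fin 4) :
    solidAngleDeriv i r r = 0 := by
  simp [solidAngleDeriv, (hr i).ne']

theorem sum_mul_solidAngleDeriv_self {r : Fin 4 → ℝ} (hr : ∀ i, 0 < r i) (x : Fin 4 → ℝ) :
    ∑ i, x i * solidAngleDeriv i r x =
      -dirichletForm (r 0) (r 1) (r 2) (r 3) (x 0) (x 1) (x 2) (x 3) := by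
  have h := fun i => (hr i).ne'
  have e : ∀ i j, x i * x j + x j * x i - r j / r i * (x i * x i) - r i / r j * (x j * x j) =
      -(r i * r j * (x i / r i - x j / r j) ^ 2) := by
    intro i j
    have := h i
    have := h j
    field_simp
    ring
  rw [sum_mul_solidAngleDeriv, dirichletForm]
  simp only [e]
  ring

theorem contDiffAt_totalS {r : Fin 4 → ℝ} (h : r ∈ conformalSet) {n : WithTop ℕ∞} :
    ContDiffAt ℝ n totalS r := by
  unfold totalS
  exact ContDiffAt.sum fun i _ =>
    (contDiff_apply ℝ ℝ i).contDiffAt.mul (contDiffAt_solidAngle h i)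

/-- By Schläfli's formula the gradient of `totalS` consists of the solid angles. -/
theorem pderiv_totalS {r : Fin 4 → ℝ} (h : r ∈ conformalSet) (j : Fin 4) :
    pderiv j totalS r = solidAngle j r := by
  have hd : HasFDerivAt totalS
      (∑ i, (r i • fderiv ℝ (solidAngle i) r +
        solidAngle i r • (ContinuousLinearMap.proj i : (Fin 4 → ℝ) →L[ℝ] ℝ))) r := by
    unfold totalS
    exact HasFDerivAt.fun_sum fun i _ =>
      (hasFDerivAt_apply i r).mul (differentiableAt_solidAngle h i).hasFDerivAt
  have hs := sum_radius_mul_solidAngleDeriv h.1 (Pi.single j 1)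
  rw [pderiv, hd.fderiv]
  simp [Finset.sum_add_distrib, fderiv_solidAngle h, hs, Pi.single_apply]

theorem hessian_totalS {r : Fin 4 → ℝ} (h : r ∈ conformalSet) (i j : Fin 4) :
    hessian totalS r i j = pderiv j (solidAngle i) r := by
  have he : pderiv j totalS =ᶠ[nhds r] solidAngle j := by
    filter_upwards [isOpen_conformalSet.mem_nhds h] with s hs
    exact pderiv_totalS hs j
  rw [hessian, Matrix.of_apply, pderiv, he.fderiv_eq, pderiv, fderiv_solidAngle h,
    fderiv_solidAngle h, solidAngleDeriv_single_comm]

theorem hessian_totalS_mulVec {r : Fin 4 → ℝ} (h : r ∈ conformalSet) (x : Fin 4 → ℝ) :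
    (hessian totalS r).mulVec x = fun i => solidAngleDeriv i r x := by
  ext i
  rw [← fderiv_solidAngle h, Matrix.mulVec, dotProduct]
  conv_rhs => rw [pi_eq_sum_univ' x]
  simp [hessian_totalS h, pderiv, map_sum, mul_comm]

theorem hessian_totalS_isSymm {r : Fin 4 → ℝ} (h : r ∈ conformalSet) (i j : Fin 4) :
    hessian totalS r i j = hessian totalS r j i := by
  rw [hessian_totalS h, hessian_totalS h, pderiv, pderiv, fderiv_solidAngle h,
    fderiv_solidAngle h, solidAngleDeriv_single_comm]

/-- The Hessian is negative off the line spanned by the vector of radii. -/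
theorem dotProduct_hessian_totalS_neg {r : Fin 4 → ℝ} (h : r ∈ conformalSet) {x : Fin 4 → ℝ}
    (hx : x ∉ Submodule.span ℝ {r}) : x ⬝ᵥ (hessian totalS r).mulVec x < 0 := by
  rw [hessian_totalS_mulVec h, dotProduct, sum_mul_solidAngleDeriv_self h.1, neg_lt_zero]
  refine dirichletForm_pos (h.1 0) (h.1 1) (h.1 2) (h.1 3) (mem_conformalSet_iff.1 h).2 _ _ _ _ ?_
  rintro ⟨h0, h1, h2⟩
  refine hx (Submodule.mem_span_singleton.2 ⟨x 3 / r 3, ?_⟩)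
  have e : ∀ i, x i / r i = x 3 / r 3 := by
    intro i
    fin_cases i
    exacts [h0, h1, h2, rfl]
  ext i
  rw [Pi.smul_apply, smul_eq_mul, ← e i, div_mul_cancel₀ _ (h.1 i).ne']

theorem hessian_totalS_mulVec_self {r : Fin 4 → ℝ} (h : r ∈ conformalSet) :
    (hessian totalS r).mulVec r = 0 := by
  rw [hessian_totalS_mulVec h]
  ext i
  exact solidAngleDeriv_self h.1 i

theorem posSemidef_neg_hessian_totalS {r : Fin 4 → ℝ} (h : r ∈ conformalSet) :
    (-(hessian totalS r)).PosSemidef := by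
  refine Matrix.PosSemidef.of_dotProduct_mulVec_nonneg ?_ fun x => ?_
  · ext i j
    simp [hessian_totalS_isSymm h i j]
  · rw [star_trivial, Matrix.neg_mulVec, dotProduct_neg, neg_nonneg]
    by_cases hx : x ∈ Submodule.span ℝ {r}
    · obtain ⟨t, rfl⟩ := Submodule.mem_span_singleton.1 hx
      simp [Matrix.mulVec_smul, hessian_totalS_mulVec_self h]
    · exact (dotProduct_hessian_totalS_neg h hx).le

theorem ker_hessian_totalS {r : Fin 4 → ℝ} (h : r ∈ conformalSet) :
    LinearMap.ker (Matrix.toLin' (hessian totalS r)) = Submodule.span ℝ {r} := by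
  refine le_antisymm (fun x hx => ?_) ?_
  · by_contra hc
    have := dotProduct_hessian_totalS_neg h hc
    rw [LinearMap.mem_ker, Matrix.toLin'_apply] at hx
    simp [hx] at this
  · rw [Submodule.span_singleton_le_iff_mem, LinearMap.mem_ker, Matrix.toLin'_apply]
    exact hessian_totalS_mulVec_self h

end ConformalSimplex

end

open ConformalSimplex in
theorem lemma1p2 :
    IsOpen conformalSet ∧
    ∀ r ∈ conformalSet,
      ContDiffAt ℝ 2 totalS r ∧
      (∀ i, DifferentiableAt ℝ (solidAngle i) r) ∧
      (∀ i j, hessian totalS r i j = pderiv j (solidAngle i) r) ∧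
      (-(hessian totalS r)).PosSemidef ∧
      LinearMap.ker (Matrix.toLin' (hessian totalS r)) = Submodule.span ℝ {r} :=
  ⟨isOpen_conformalSet, fun _ h => ⟨contDiffAt_totalS h, differentiableAt_solidAngle h,
    hessian_totalS h, posSemidef_neg_hessian_totalS h, ker_hessian_totalS h⟩⟩
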